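/- **Setting.** Fix sets $\mathsf N$ (signature constructor names), $\mathsf X$ (type variables) and $\mathsf L$ (labels). *Generic signatures.* Generic signature names and type names are given by $\mathsf{GN}=\mathsf N\times\mathsf{GNX}^*$, $\mathsf{GNX}=\mathsf{GN}+\mathsf X$. A signature constructor is a tuple in $\mathsf N\times\mathsf X^*\times\mathsf{GN}^*\times(\mathsf L\times\mathsf{GNX})^*\times(\mathsf L\times\mathsf{GNX}^*\times\mathsf{GNX})^*$ (name, declared type variables, supersignatures, field signatures, method signatures). A signature constructor environment $sce$ is a finite partial function from names to signature constructors. It is well-formed if: each name is bound to a constructor of that name; in each constructor the type variables, the supersignatures, the field labels and the method labels are without repetition; every constructor name occurring in a constructor is bound and has the right number of arguments, and every type variable occurring is declared; there are no cycles among the supersignature constructors; and every member of a supersignature constructor, after substituting the type arguments given in the supersignatures component for its type variables, is a member with the same signature of the subsignature constructor. A *generic object signature* $gos=(ggnm,sce)$ is a pair of a well-formed $sce$ and a generic signature name $ggnm$ without type variables that is well-formed in $sce$; generic object signatures are identified up to renaming of declared type variables. Substituting the arguments of $ggnm$ for the type variables of the constructor it names yields the ground signature defined by $gos$. Subsigning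 is $$(ggnm_2,sce_2)\trianglelefteq(ggnm_1,sce_1)\iff sce_2\supseteq sce_1\ \wedge\ \bigl(ggnm_2=ggnm_1\vee ggnm_1\in gss(sce_2,ggnm_2)\bigr),$$ where $\supseteq$ is up to renaming of type variables and $gss(sce,ggnm)$ is the set of names of all (transitive) ground supersignatures of $ggnm$ in $sce$. *Generic objects.* Let $\mathcal O$ be the canonical solution (the limit of the iterates starting from the one-point domain) of the domain equation $$\mathcal O=\mathcal S\times(\mathcal L\multimap\mathcal O)\times(\mathcal L\multimap(\mathcal O^*\to\mathcal O)),$$ where $\mathcal S$ is the flat domain of generic object signatures, $\times$ is the strict product, $\mathcal L\multimap D$ consists of $\bot$ and of the records, i.e. finite sets of labels with an element of $D$ for each label (records being comparable only if they have the same labels, and then label by label), $D^*$ consists of $\bot$ and of the finite sequences of nonbottom elements of $D$ (comparable only if of equal length, and then entry by entry), and $\to$ gives the strict Scott-continuous functions, ordered pointwise. Filtering is the least strict continuous $F:\mathcal O\to\mathcal O$ such that: an object whose field and method labels are not those of the ground signature defined by its signature is mapped to $\bot$; otherwise the signature and the labels are kept, each field value is replaced by its image under $F$, and by $\bot$ if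 its signature does not subsign the declared type of the field (in the environment of the object's signature); and each method is replaced by the one that applies $F$ to its arguments and to its result, and returns $\bot$ if the number of arguments is wrong or if the signature of an argument or of the result does not subsign the declared type. The domain $G\mathcal O$ of generic objects is the set of objects in $\mathcal O$ that are fixed by filtering, with the order $\sqsubseteq$ of $\mathcal O$. For a generic object signature $gos$ let $$\mathbb{GS}[gos]=\{go\in G\mathcal O\mid \exists\,goss,\,gr:\ goss\trianglelefteq gos,\ (goss,gr)\in G\mathcal O,\ go\sqsubseteq(goss,gr)\},$$ where $goss$ ranges over the generic object signatures and $gr$ over the pairs of a nonbottom field record and a nonbottom method record. **Claim.** For every generic object signature $gos$, the generic nominal type $\mathbb{GS}[gos]$ is a weak ideal in $G\mathcal O$: it is nonempty, downward closed, and every nonempty directed subset of $\mathbb{GS}[gos]$ has a least upper bound in $G\mathcal O$, which belongs to $\mathbb{GS}[gos]$. -/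

import Mathlib

namespace GNOOP

/-! ### Directed-complete partial orders and domain constructors -/

/-- Every nonempty directed subset has a least upper bound. -/
class DirComplete (α : Type) [PartialOrder α] : Prop where
  exists_isLUB : ∀ d : Set α, d.Nonempty → DirectedOn (· ≤ ·) d → ∃ a, IsLUB d a

/-- A type with the discrete (equality) order. -/
structure Discrete (α : Type) where
  val : α

instance (α : Type) : PartialOrder (Discrete α) where
  le a b := a = b
  le_refl _ := rfl
  le_trans _ _ _ h₁ h₂ := h₁.trans h₂
  le_antisymm _ _ h _ := h

theorem Discrete.eq_of_le {α : Type} {a b : Discrete α} (h : a ≤ b) : a = b := h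

theorem scott_discrete {α β : Type} [PartialOrder β] (f : Discrete α → β) :
    ScottContinuous f := by
  intro d hne _ a ha
  obtain ⟨x, hx⟩ := hne
  have hd : d = {a} := by
    ext y
    constructor
    · intro hy; exact Discrete.eq_of_le (ha.1 hy)
    · rintro rfl; rwa [← Discrete.eq_of_le (ha.1 hx)]
  rw [hd, Set.image_singleton]
  exact isLUB_singleton

instance (α : Type) : DirComplete (Discrete α) where
  exists_isLUB d hne hd := by
    obtain ⟨x, hx⟩ := hne
    refine ⟨x, fun y hy => ?_, fun u hu => hu hx⟩
    obtain ⟨z, _, h₁, h₂⟩ := hd x hx y hy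
    rw [Discrete.eq_of_le h₁, ← Discrete.eq_of_le h₂]

instance (α β : Type) [PartialOrder α] [PartialOrder β] [DirComplete α] [DirComplete β] :
    DirComplete (α × β) where
  exists_isLUB d hne hd := by
    obtain ⟨a, ha⟩ := DirComplete.exists_isLUB (Prod.fst '' d) (hne.image _)
      (hd.mono_comp fun _ _ h => h.1)
    obtain ⟨b, hb⟩ := DirComplete.exists_isLUB (Prod.snd '' d) (hne.image _)
      (hd.mono_comp fun _ _ h => h.2)
    exact ⟨(a, b), isLUB_prod.2 ⟨ha, hb⟩⟩

instance (ι : Type) (α : ι → Type) [∀ i, PartialOrder (α i)] [∀ i, DirComplete (α i)] :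
    DirComplete (∀ i, α i) where
  exists_isLUB d hne hd := by
    choose a ha using fun i => DirComplete.exists_isLUB (Function.eval i '' d) (hne.image _)
      (hd.mono_comp fun _ _ h => h i)
    exact ⟨a, isLUB_pi.2 ha⟩

theorem scott_pi {α ι : Type} {β : ι → Type} [Preorder α] [∀ i, Preorder (β i)]
    {f : α → ∀ i, β i} (h : ∀ i, ScottContinuous fun a => f a i) : ScottContinuous f := by
  intro d hne hd a ha
  refine isLUB_pi.2 fun i => ?_
  rw [Set.image_image]
  exact h i hne hd ha

theorem scott_eval {ι : Type} {β : ι → Type} [∀ i, Preorder (β i)] (i : ι) :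
    ScottContinuous fun f : ∀ i, β i => f i := by
  intro d _ _ a ha
  exact isLUB_pi.1 ha i

theorem scott_eval_comp {α ι : Type} {β : ι → Type} [Preorder α] [∀ i, Preorder (β i)]
    {f : α → ∀ i, β i} (hf : ScottContinuous f) (i : ι) : ScottContinuous fun a => f a i :=
  ScottContinuous.comp hf (scott_eval i)

/-- A property that is inherited by least upper bounds of directed sets. -/
def DirClosed {α : Type} [PartialOrder α] (p : α → Prop) : Prop :=
  ∀ d : Set α, d.Nonempty → DirectedOn (· ≤ ·) d → (∀ x ∈ d, p x) → ∀ a, IsLUB d a → p a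

theorem DirClosed.exists_isLUB {α : Type} [PartialOrder α] [DirComplete α] {p : α → Prop}
    (hp : DirClosed p) (d : Set {x // p x}) (hne : d.Nonempty) (hd : DirectedOn (· ≤ ·) d) :
    ∃ a, IsLUB d a ∧ IsLUB (Subtype.val '' d) a.1 := by
  have hd' : DirectedOn (· ≤ ·) (Subtype.val '' d) := hd.mono_comp fun _ _ h => h
  obtain ⟨a, ha⟩ := DirComplete.exists_isLUB _ (hne.image Subtype.val) hd'
  have hpa := hp _ (hne.image _) hd' (by rintro _ ⟨x, _, rfl⟩; exact x.2) a ha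
  exact ⟨⟨a, hpa⟩, IsLUB.of_image (f := Subtype.val) Iff.rfl ha, ha⟩

theorem DirClosed.dirComplete {α : Type} [PartialOrder α] [DirComplete α] {p : α → Prop}
    (hp : DirClosed p) : DirComplete {x // p x} where
  exists_isLUB d hne hd := (hp.exists_isLUB d hne hd).imp fun _ h => h.1

theorem DirClosed.scott_val {α : Type} [PartialOrder α] [DirComplete α] {p : α → Prop}
    (hp : DirClosed p) : ScottContinuous (Subtype.val : {x // p x} → α) := by
  intro d hne hd a ha
  obtain ⟨b, hb, hb'⟩ := hp.exists_isLUB d hne hd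
  rwa [ha.unique hb]

theorem scott_subtype {α β : Type} [PartialOrder α] [PartialOrder β] {p : β → Prop}
    {f : α → {x // p x}} (h : ScottContinuous fun a => (f a).1) : ScottContinuous f := by
  intro d hne hd a ha
  refine IsLUB.of_image (f := Subtype.val) Iff.rfl ?_
  rw [Set.image_image]
  exact h hne hd ha

theorem scott_pair_left {α β γ : Type} [Preorder α] [Preorder β] [Preorder γ]
    {f : α × β → γ} (hf : ScottContinuous f) (b : β) : ScottContinuous fun a => f (a, b) :=
  ScottContinuous.comp (f := fun a => (a, b))
    (ScottContinuous.prodMk ScottContinuous.id (ScottContinuous.const b)) hf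

theorem scott_pair_right {α β γ : Type} [Preorder α] [Preorder β] [Preorder γ]
    {f : α × β → γ} (hf : ScottContinuous f) (a : α) : ScottContinuous fun b => f (a, b) :=
  ScottContinuous.comp (f := fun b => (a, b))
    (ScottContinuous.prodMk (ScottContinuous.const a) ScottContinuous.id) hf

theorem scott_pair {α β γ δ : Type} [Preorder α] [Preorder β] [Preorder γ]
    [Preorder δ] {h : β × γ → δ} (hh : ScottContinuous h) {f : α → β} {g : α → γ}
    (hf : ScottContinuous f) (hg : ScottContinuous g) : ScottContinuous fun a => h (f a, g a) :=
  ScottContinuous.comp (ScottContinuous.prodMk hf hg) hh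

theorem scott_isLUB_range {α β : Type} [PartialOrder α] [PartialOrder β] {f : α → β}
    (hf : ScottContinuous f) {u : ℕ → α} (hu : Monotone u) {a : α} (ha : IsLUB (Set.range u) a) :
    IsLUB (Set.range fun n => f (u n)) (f a) := by
  have := hf (Set.range_nonempty u) (directedOn_range.2 hu.directed_le) ha
  rwa [← Set.range_comp] at this

/-! #### Lifting -/

theorem isLUB_coe_preimage {α : Type} [PartialOrder α] {d : Set (WithBot α)} {a : α}
    (ha : IsLUB d (a : WithBot α)) : IsLUB {x : α | (x : WithBot α) ∈ d} a := by
  refine ⟨fun x hx => WithBot.coe_le_coe.1 (ha.1 hx), fun u hu => ?_⟩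
  refine WithBot.coe_le_coe.1 (ha.2 fun y hy => ?_)
  induction y using WithBot.recBotCoe with
  | bot => exact bot_le
  | coe y => exact WithBot.coe_le_coe.2 (hu hy)

theorem directedOn_coe_preimage {α : Type} [PartialOrder α] {d : Set (WithBot α)}
    (hd : DirectedOn (· ≤ ·) d) : DirectedOn (· ≤ ·) {x : α | (x : WithBot α) ∈ d} := by
  intro x hx y hy
  obtain ⟨z, hz, h₁, h₂⟩ := hd _ hx _ hy
  induction z using WithBot.recBotCoe with
  | bot => exact absurd h₁ (WithBot.not_coe_le_bot x)
  | coe z => exact ⟨z, hz, WithBot.coe_le_coe.1 h₁, WithBot.coe_le_coe.1 h₂⟩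

theorem isLUB_of_coe_preimage {α : Type} [PartialOrder α] {d : Set (WithBot α)} {a : α}
    (hne : {x : α | (x : WithBot α) ∈ d}.Nonempty)
    (ha : IsLUB {x : α | (x : WithBot α) ∈ d} a) : IsLUB d (a : WithBot α) := by
  constructor
  · intro y hy
    induction y using WithBot.recBotCoe with
    | bot => exact bot_le
    | coe y => exact WithBot.coe_le_coe.2 (ha.1 hy)
  · intro u hu
    induction u using WithBot.recBotCoe with
    | bot => obtain ⟨x, hx⟩ := hne; exact absurd (hu hx) (WithBot.not_coe_le_bot x)
    | coe u => exact WithBot.coe_le_coe.2 (ha.2 fun x hx => WithBot.coe_le_coe.1 (hu hx))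

instance (α : Type) [PartialOrder α] [DirComplete α] : DirComplete (WithBot α) where
  exists_isLUB d hne hd := by
    by_cases h : {x : α | (x : WithBot α) ∈ d}.Nonempty
    · obtain ⟨a, ha⟩ := DirComplete.exists_isLUB _ h (directedOn_coe_preimage hd)
      exact ⟨a, isLUB_of_coe_preimage h ha⟩
    · refine ⟨⊥, fun y hy => ?_, fun _ _ => bot_le⟩
      induction y using WithBot.recBotCoe with
      | bot => exact le_rfl
      | coe y => exact absurd ⟨y, hy⟩ h

/-- The strict extension of a map to a lifted domain. -/
def strictExt {α β : Type} [PartialOrder α] [PartialOrder β] [OrderBot β] (h : α → β) :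
    WithBot α → β :=
  fun x => WithBot.recBotCoe (C := fun _ => β) ⊥ h x

theorem scott_strictExt {α β : Type} [PartialOrder α] [PartialOrder β] [OrderBot β] {h : α → β}
    (hh : ScottContinuous h) : ScottContinuous (strictExt h) := by
  intro d hne hd a ha
  induction a using WithBot.recBotCoe with
  | bot =>
    have : d = {⊥} := by
      refine Set.eq_singleton_iff_nonempty_unique_mem.2 ⟨hne, fun x hx => le_bot_iff.1 (ha.1 hx)⟩
    rw [this, Set.image_singleton]
    exact isLUB_singleton
  | coe a =>
    have hne' : {x : α | (x : WithBot α) ∈ d}.Nonempty := by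
      by_contra hcon
      have : (a : WithBot α) ≤ ⊥ := ha.2 fun y hy => by
        induction y using WithBot.recBotCoe with
        | bot => exact le_rfl
        | coe y => exact absurd ⟨y, hy⟩ hcon
      exact WithBot.not_coe_le_bot a this
    have := hh hne' (directedOn_coe_preimage hd) (isLUB_coe_preimage ha)
    constructor
    · rintro _ ⟨y, hy, rfl⟩
      induction y using WithBot.recBotCoe with
      | bot => exact bot_le
      | coe y => exact this.1 ⟨y, hy, rfl⟩
    · intro u hu
      refine this.2 ?_
      rintro _ ⟨y, hy, rfl⟩
      exact hu ⟨_, hy, rfl⟩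

theorem scott_coe {α : Type} [PartialOrder α] :
    ScottContinuous ((↑) : α → WithBot α) := by
  intro d hne _ a ha
  have hd : {x : α | (x : WithBot α) ∈ ((↑) : α → WithBot α) '' d} = d := by
    ext x; simp
  exact isLUB_of_coe_preimage (by rwa [hd]) (by rwa [hd])

/-! #### Strict continuous functions -/

/-- The domain of strict Scott-continuous functions, ordered pointwise. -/
abbrev StrictHom (α β : Type) [PartialOrder α] [OrderBot α] [PartialOrder β] [OrderBot β] : Type :=
  {f : α → β // ScottContinuous f ∧ f ⊥ = ⊥}

section StrictHom

variable {α β γ : Type} [PartialOrder α] [OrderBot α] [PartialOrder β] [OrderBot β]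
  [PartialOrder γ] [OrderBot γ]

instance : OrderBot (StrictHom α β) where
  bot := ⟨fun _ => ⊥, ScottContinuous.const ⊥, rfl⟩
  bot_le _ := fun _ => bot_le

theorem StrictHom.dirClosed :
    DirClosed fun f : α → β => ScottContinuous f ∧ f ⊥ = ⊥ := by
  intro D hne _ hD g hg
  have hg' := isLUB_pi.1 hg
  have hmono : Monotone g := by
    intro x y hxy
    refine (hg' x).2 ?_
    rintro _ ⟨f, hf, rfl⟩
    exact ((hD f hf).1.monotone hxy).trans ((hg' y).1 ⟨f, hf, rfl⟩)
  refine ⟨fun d hdne hd a ha => ⟨?_, fun u hu => ?_⟩, ?_⟩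
  · rintro _ ⟨x, hx, rfl⟩
    exact hmono (ha.1 hx)
  · refine (hg' a).2 ?_
    rintro _ ⟨f, hf, rfl⟩
    refine ((hD f hf).1 hdne hd ha).2 ?_
    rintro _ ⟨x, hx, rfl⟩
    exact ((hg' x).1 ⟨f, hf, rfl⟩).trans (hu ⟨x, hx, rfl⟩)
  · refine le_bot_iff.1 ((hg' ⊥).2 ?_)
    rintro _ ⟨f, hf, rfl⟩
    exact (hD f hf).2.le

instance [DirComplete β] : DirComplete (StrictHom α β) := StrictHom.dirClosed.dirComplete

theorem scott_apply [DirComplete β] :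
    ScottContinuous fun p : StrictHom α β × α => p.1.1 p.2 := by
  refine ScottContinuous.fromProd (fun f => f.2.1) fun a => ?_
  exact (StrictHom.dirClosed.scott_val).comp (scott_eval a)

/-- Identity. -/
def StrictHom.id : StrictHom α α := ⟨fun x => x, ScottContinuous.id, rfl⟩

/-- Composition. -/
def StrictHom.comp (g : StrictHom β γ) (f : StrictHom α β) : StrictHom α γ :=
  ⟨fun x => g.1 (f.1 x), ScottContinuous.comp f.2.1 g.2.1, by
    show g.1 (f.1 ⊥) = ⊥
    rw [f.2.2, g.2.2]⟩

/-- The strict continuous extension of a continuous map to a lifted domain. -/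
def StrictHom.ext {δ : Type} [PartialOrder δ] (h : δ → β) (hh : ScottContinuous h) :
    StrictHom (WithBot δ) β :=
  ⟨strictExt h, scott_strictExt hh, rfl⟩

/-- Sandwiching a function between a post- and a pre-composed function. -/
def StrictHom.conj {α' β' : Type} [PartialOrder α'] [OrderBot α'] [PartialOrder β'] [OrderBot β']
    [DirComplete β] (f : StrictHom β β') (g : StrictHom α' α) :
    StrictHom (StrictHom α β) (StrictHom α' β') :=
  ⟨fun m => f.comp (m.comp g), scott_subtype (scott_pi fun x =>
    ((StrictHom.dirClosed.scott_val).comp (scott_eval (g.1 x))).comp f.2.1),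
    Subtype.ext (funext fun _ => f.2.2)⟩

end StrictHom

/-! #### Records -/

/-- The nonbottom records over `D` with labels in `L`: a finite set of labels, the shape of the
record, and an element of `D` (possibly `⊥`) for every label of the shape.  By convention the
value at a label outside of the shape is `⊥`.  Two records are comparable only if they have the
same shape, and they are then compared label by label.  The record domain `L ⊸ D` is
`WithBot (Record L D)`. -/
abbrev Record (L D : Type) [PartialOrder D] [OrderBot D] : Type :=
  {p : Discrete (Finset L) × (L → D) // ∀ l, l ∉ p.1.val → p.2 l = ⊥}

section Record

variable {L D E : Type} [PartialOrder D] [OrderBot D] [PartialOrder E] [OrderBot E]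

theorem isLUB_bot_of_forall {D : Type} [PartialOrder D] [OrderBot D] {d : Set D} {a : D}
    (ha : IsLUB d a) (h : ∀ x ∈ d, x = ⊥) : a = ⊥ :=
  le_bot_iff.1 (ha.2 fun x hx => (h x hx).le)

theorem Record.dirClosed : DirClosed fun p : Discrete (Finset L) × (L → D) =>
    ∀ l, l ∉ p.1.val → p.2 l = ⊥ := by
  intro d _ _ hd a ha l hl
  refine isLUB_bot_of_forall (isLUB_pi.1 (isLUB_prod.1 ha).2 l) ?_
  rintro _ ⟨_, ⟨x, hx, rfl⟩, rfl⟩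
  refine hd x hx l ?_
  rwa [Discrete.eq_of_le (ha.1 hx).1]

instance [DirComplete D] : DirComplete (Record L D) := Record.dirClosed.dirComplete

/-- The set of labels of a record. -/
def Record.shape (r : Record L D) : Finset L := r.1.1.val

/-- Apply a strict function at each label. -/
def Record.map (φ : L → StrictHom D E) (r : Record L D) : Record L E :=
  ⟨(r.1.1, fun l => (φ l).1 (r.1.2 l)), fun l hl => by
    show (φ l).1 (r.1.2 l) = ⊥
    rw [r.2 l hl, (φ l).2.2]⟩

theorem Record.scott_map [DirComplete D] [DirComplete E] :
    ScottContinuous fun p : (L → StrictHom D E) × Record L D => Record.map p.1 p.2 := by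
  have h2 : ScottContinuous fun p : (L → StrictHom D E) × Record L D => p.2.1 :=
    ScottContinuous.snd.comp Record.dirClosed.scott_val
  refine scott_subtype (ScottContinuous.prodMk (h2.comp ScottContinuous.fst) (scott_pi fun l => ?_))
  exact ScottContinuous.comp (ScottContinuous.prodMk (ScottContinuous.fst.comp (scott_eval l))
    ((h2.comp ScottContinuous.snd).comp (scott_eval l))) scott_apply

end Record

/-! #### Finite sequences -/

/-- Finite sequences of elements of `D`; the entry at an index beyond the length is `⊥` by
convention.  Only sequences of the same length are comparable. -/
abbrev PreSeq (D : Type) [PartialOrder D] [OrderBot D] : Type :=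
  {p : Discrete ℕ × (ℕ → D) // ∀ i, p.1.val ≤ i → p.2 i = ⊥}

/-- Finite sequences of nonbottom elements of `D`: the entry at `i` is `⊥` exactly if `i` is beyond
the length. -/
abbrev ProperSeq (D : Type) [PartialOrder D] [OrderBot D] : Type :=
  {p : Discrete ℕ × (ℕ → D) // ∀ i, p.2 i = ⊥ ↔ p.1.val ≤ i}

/-- The domain `D*`, the coalesced sum of the strict finite powers of `D`. -/
abbrev Seq (D : Type) [PartialOrder D] [OrderBot D] : Type := WithBot (ProperSeq D)

section Seq

variable {D E : Type} [PartialOrder D] [OrderBot D] [PartialOrder E] [OrderBot E]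

theorem PreSeq.dirClosed : DirClosed fun p : Discrete ℕ × (ℕ → D) =>
    ∀ i, p.1.val ≤ i → p.2 i = ⊥ := by
  intro d _ _ hd a ha l hl
  refine isLUB_bot_of_forall (isLUB_pi.1 (isLUB_prod.1 ha).2 l) ?_
  rintro _ ⟨_, ⟨x, hx, rfl⟩, rfl⟩
  refine hd x hx l ?_
  rwa [Discrete.eq_of_le (ha.1 hx).1]

theorem ProperSeq.dirClosed : DirClosed fun p : Discrete ℕ × (ℕ → D) =>
    ∀ i, p.2 i = ⊥ ↔ p.1.val ≤ i := by
  intro d hne hdir hd a ha i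
  constructor
  · intro h
    obtain ⟨x, hx⟩ := hne
    have h1 := (ha.1 hx).1
    rw [← Discrete.eq_of_le h1]
    exact (hd x hx i).1 (le_bot_iff.1 (((ha.1 hx).2 i).trans h.le))
  · exact PreSeq.dirClosed d hne hdir (fun x hx j hj => (hd x hx j).2 hj) a ha i

instance [DirComplete D] : DirComplete (PreSeq D) := PreSeq.dirClosed.dirComplete

instance [DirComplete D] : DirComplete (ProperSeq D) := ProperSeq.dirClosed.dirComplete

open Classical in
/-- Identify all sequences that have an entry `⊥`. -/
noncomputable def PreSeq.squash (s : PreSeq D) : Seq D :=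
  if h : ∀ i, s.1.2 i = ⊥ → s.1.1.val ≤ i then
    ((⟨s.1, fun i => ⟨h i, s.2 i⟩⟩ : ProperSeq D) : WithBot (ProperSeq D)) else ⊥

theorem PreSeq.squash_of {s : PreSeq D} (h : ∀ i, s.1.2 i = ⊥ → s.1.1.val ≤ i) :
    s.squash = ((⟨s.1, fun i => ⟨h i, s.2 i⟩⟩ : ProperSeq D) : WithBot (ProperSeq D)) := dif_pos h

theorem PreSeq.squash_mono : Monotone (PreSeq.squash (D := D)) := by
  intro s t hst
  by_cases h : ∀ i, s.1.2 i = ⊥ → s.1.1.val ≤ i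
  · have ht : ∀ i, t.1.2 i = ⊥ → t.1.1.val ≤ i := fun i hi => by
      have h1 : s.1.1 ≤ t.1.1 := hst.1
      have h2 : s.1.2 i ≤ t.1.2 i := hst.2 i
      rw [← Discrete.eq_of_le h1]
      exact h i (le_bot_iff.1 (h2.trans hi.le))
    rw [squash_of h, squash_of ht]
    exact WithBot.coe_le_coe.2 hst
  · rw [PreSeq.squash, dif_neg h]
    exact bot_le

theorem PreSeq.scott_squash [DirComplete D] : ScottContinuous (PreSeq.squash (D := D)) := by
  intro d hne hd a ha
  refine ⟨?_, fun u hu => ?_⟩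
  · rintro _ ⟨x, hx, rfl⟩
    exact squash_mono (ha.1 hx)
  by_cases h : ∀ i, a.1.2 i = ⊥ → a.1.1.val ≤ i
  · have hval := PreSeq.dirClosed.scott_val hne hd ha
    have hcomp := isLUB_pi.1 (isLUB_prod.1 hval).2
    have hlen : ∀ x ∈ d, x.1.1 = a.1.1 := fun x hx => Discrete.eq_of_le (ha.1 hx).1
    have key : ∀ n, n ≤ a.1.1.val → ∃ x ∈ d, ∀ i < n, x.1.2 i ≠ ⊥ := by
      intro n
      induction n with
      | zero => intro _; obtain ⟨x, hx⟩ := hne; exact ⟨x, hx, fun i hi => absurd hi (by omega)⟩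
      | succ n ih =>
        intro hn
        obtain ⟨x, hx, hx'⟩ := ih (by omega)
        have : ∃ y ∈ d, y.1.2 n ≠ ⊥ := by
          by_contra hcon
          push Not at hcon
          have := h n (isLUB_bot_of_forall (hcomp n) (by
            rintro _ ⟨_, ⟨_, ⟨y, hy, rfl⟩, rfl⟩, rfl⟩
            exact hcon y hy))
          omega
        obtain ⟨y, hy, hy'⟩ := this
        obtain ⟨z, hz, h1, h2⟩ := hd x hx y hy
        refine ⟨z, hz, fun i hi hzi => ?_⟩
        rcases Nat.lt_succ_iff_lt_or_eq.1 hi with hi | rfl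
        · exact hx' i hi (le_bot_iff.1 ((h1.2 i).trans hzi.le))
        · exact hy' (le_bot_iff.1 ((h2.2 i).trans hzi.le))
    obtain ⟨x, hx, hx'⟩ := key _ le_rfl
    have hproper : ∀ z ∈ d, x ≤ z → ∀ i, z.1.2 i = ⊥ → z.1.1.val ≤ i := by
      intro z hz hxz i hi
      rw [hlen z hz]
      by_contra hcon
      exact hx' i (by omega) (le_bot_iff.1 ((hxz.2 i).trans hi.le))
    rw [squash_of h]
    induction u using WithBot.recBotCoe with
    | bot =>
      have := hu ⟨x, hx, rfl⟩
      rw [squash_of (hproper x hx le_rfl)] at this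
      exact absurd this (WithBot.not_coe_le_bot _)
    | coe u =>
      refine WithBot.coe_le_coe.2 (?_ : a.1 ≤ u.1)
      refine hval.2 ?_
      rintro _ ⟨y, hy, rfl⟩
      obtain ⟨z, hz, h1, h2⟩ := hd x hx y hy
      have := hu ⟨z, hz, rfl⟩
      rw [squash_of (hproper z hz h1)] at this
      exact le_trans (h2 : y.1 ≤ z.1) (Subtype.coe_le_coe.2 (WithBot.coe_le_coe.1 this))
  · rw [PreSeq.squash, dif_neg h]
    exact bot_le

/-- Apply strict functions entry by entry, to a sequence without entries `⊥`. -/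
noncomputable def Seq.mapProper (φ : ℕ → StrictHom D E) (s : ProperSeq D) : Seq E :=
  PreSeq.squash ⟨(s.1.1, fun i => (φ i).1 (s.1.2 i)), fun i hi => by
    show (φ i).1 (s.1.2 i) = ⊥
    rw [(s.2 i).2 hi, (φ i).2.2]⟩

theorem Seq.scott_mapProper [DirComplete D] [DirComplete E] :
    ScottContinuous fun p : (ℕ → StrictHom D E) × ProperSeq D => Seq.mapProper p.1 p.2 := by
  have h2 : ScottContinuous fun p : (ℕ → StrictHom D E) × ProperSeq D => p.2.1 :=
    ScottContinuous.snd.comp ProperSeq.dirClosed.scott_val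
  refine ScottContinuous.comp (scott_subtype (ScottContinuous.prodMk (h2.comp ScottContinuous.fst)
    (scott_pi fun l => ?_))) PreSeq.scott_squash
  exact ScottContinuous.comp (ScottContinuous.prodMk (ScottContinuous.fst.comp (scott_eval l))
    ((h2.comp ScottContinuous.snd).comp (scott_eval l))) scott_apply

/-- Apply strict functions entry by entry; the result is `⊥` if one of its entries is. -/
noncomputable def Seq.map [DirComplete D] [DirComplete E] (φ : ℕ → StrictHom D E) :
    StrictHom (Seq D) (Seq E) :=
  StrictHom.ext (Seq.mapProper φ) (scott_pair_right Seq.scott_mapProper φ)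

theorem Seq.map_squash [DirComplete D] [DirComplete E] (φ : ℕ → StrictHom D E) (s : PreSeq D) :
    (Seq.map φ).1 s.squash = PreSeq.squash ⟨(s.1.1, fun i => (φ i).1 (s.1.2 i)), fun i hi => by
      show (φ i).1 (s.1.2 i) = ⊥
      rw [s.2 i hi, (φ i).2.2]⟩ := by
  by_cases h : ∀ i, s.1.2 i = ⊥ → s.1.1.val ≤ i
  · rw [PreSeq.squash_of h]
    rfl
  · rw [PreSeq.squash, dif_neg h, (Seq.map φ).2.2]
    push Not at h
    obtain ⟨i, hi, hlt⟩ := h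
    rw [PreSeq.squash, dif_neg]
    intro hcon
    have := hcon i (by show (φ i).1 (s.1.2 i) = ⊥; rw [hi, (φ i).2.2])
    exact absurd this (by simpa using hlt)

theorem Seq.map_id [DirComplete D] : Seq.map (fun _ => (StrictHom.id : StrictHom D D)) =
    StrictHom.id := by
  refine Subtype.ext (funext fun x => ?_)
  induction x using WithBot.recBotCoe with
  | bot => rfl
  | coe s => exact PreSeq.squash_of (s := ⟨s.1, fun i => (s.2 i).2⟩) fun i => (s.2 i).1

theorem Seq.map_comp {G : Type} [PartialOrder G] [OrderBot G] [DirComplete D] [DirComplete E]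
    [DirComplete G] (φ : ℕ → StrictHom D E) (χ : ℕ → StrictHom E G) :
    Seq.map (fun i => (χ i).comp (φ i)) = (Seq.map χ).comp (Seq.map φ) := by
  refine Subtype.ext (funext fun x => ?_)
  induction x using WithBot.recBotCoe with
  | bot => rfl
  | coe s => exact (Seq.map_squash χ ⟨(s.1.1, fun i => (φ i).1 (s.1.2 i)), fun i hi => by
      show (φ i).1 (s.1.2 i) = ⊥
      rw [(s.2 i).2 hi, (φ i).2.2]⟩).symm

theorem Seq.scott_map [DirComplete D] [DirComplete E] :
    ScottContinuous (Seq.map (D := D) (E := E)) := by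
  refine scott_subtype (scott_pi fun x => ?_)
  induction x using WithBot.recBotCoe with
  | bot => exact ScottContinuous.const ⊥
  | coe s => exact scott_pair_left Seq.scott_mapProper s

end Seq

/-! ### The domain equation -/

/-- Nonbottom elements of the right-hand side of the domain equation: a signature, a record of
fields and a record of methods, which are strict continuous functions from `D*` to `D`. -/
abbrev Cell (S L D : Type) [PartialOrder D] [OrderBot D] : Type :=
  Discrete S × Record L D × Record L (StrictHom (Seq D) D)

/-- The right-hand side `S × (L ⊸ D) × (L ⊸ (D* → D))` of the domain equation, where `S` stands
for the flat domain over the set `S` and the product is strict.  As each of the three factors is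
the lifting of its set of nonbottom elements, their strict product is the lifting of the set of
triples of nonbottom elements. -/
abbrev Obj (S L D : Type) [PartialOrder D] [OrderBot D] : Type := WithBot (Cell S L D)

section Obj

variable {S L A B C : Type} [PartialOrder A] [OrderBot A] [DirComplete A]
  [PartialOrder B] [OrderBot B] [DirComplete B] [PartialOrder C] [OrderBot C] [DirComplete C]

/-- Apply strict functions to the fields and the methods. -/
def Cell.map (φ : S → L → StrictHom A B)
    (ψ : S → L → StrictHom (StrictHom (Seq A) A) (StrictHom (Seq B) B)) (c : Cell S L A) :
    Cell S L B :=
  (c.1, Record.map (φ c.1.val) c.2.1, Record.map (ψ c.1.val) c.2.2)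

theorem Cell.scott_map : ScottContinuous fun p : ((S → L → StrictHom A B) ×
    (S → L → StrictHom (StrictHom (Seq A) A) (StrictHom (Seq B) B))) × Cell S L A =>
    Cell.map p.1.1 p.1.2 p.2 := by
  have key : ScottContinuous fun q : Discrete S × (((S → L → StrictHom A B) ×
      (S → L → StrictHom (StrictHom (Seq A) A) (StrictHom (Seq B) B))) ×
      (Record L A × Record L (StrictHom (Seq A) A))) =>
      Cell.map q.2.1.1 q.2.1.2 ((q.1, q.2.2) : Cell S L A) := by
    refine ScottContinuous.fromProd (fun s => ?_) (fun b => scott_discrete _)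
    refine ScottContinuous.prodMk (ScottContinuous.const s) (ScottContinuous.prodMk ?_ ?_)
    · have e : ScottContinuous fun b : ((S → L → StrictHom A B) ×
          (S → L → StrictHom (StrictHom (Seq A) A) (StrictHom (Seq B) B))) ×
          (Record L A × Record L (StrictHom (Seq A) A)) => b.1.1 s.val :=
        scott_eval_comp (ScottContinuous.fst.comp ScottContinuous.fst) s.val
      have := scott_pair Record.scott_map e (ScottContinuous.snd.comp ScottContinuous.fst)
      exact this
    · have e : ScottContinuous fun b : ((S → L → StrictHom A B) ×
          (S → L → StrictHom (StrictHom (Seq A) A) (StrictHom (Seq B) B))) ×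
          (Record L A × Record L (StrictHom (Seq A) A)) => b.1.2 s.val :=
        scott_eval_comp (ScottContinuous.fst.comp ScottContinuous.snd) s.val
      have := scott_pair Record.scott_map e (ScottContinuous.snd.comp ScottContinuous.snd)
      exact this
  have := scott_pair key (ScottContinuous.snd.comp ScottContinuous.fst)
    (ScottContinuous.prodMk ScottContinuous.fst (ScottContinuous.snd.comp ScottContinuous.snd))
  exact this

/-- `Cell.map` as a strict continuous function. -/
def Obj.mapWith (φ : S → L → StrictHom A B)
    (ψ : S → L → StrictHom (StrictHom (Seq A) A) (StrictHom (Seq B) B)) :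
    StrictHom (Obj S L A) (Obj S L B) :=
  StrictHom.ext (fun c => ((Cell.map φ ψ c : Cell S L B) : Obj S L B))
    (ScottContinuous.comp (scott_pair_right Cell.scott_map (φ, ψ)) scott_coe)

theorem Obj.scott_mapWith : ScottContinuous fun p : (S → L → StrictHom A B) ×
    (S → L → StrictHom (StrictHom (Seq A) A) (StrictHom (Seq B) B)) => Obj.mapWith p.1 p.2 := by
  refine scott_subtype (scott_pi fun x => ?_)
  induction x using WithBot.recBotCoe with
  | bot => exact ScottContinuous.const ⊥
  | coe c =>
    have := (scott_pair_left Cell.scott_map c).comp (scott_coe (α := Cell S L B))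
    exact this

theorem StrictHom.scott_conj {α β α' β' : Type} [PartialOrder α] [OrderBot α] [PartialOrder β]
    [OrderBot β] [PartialOrder α'] [OrderBot α'] [PartialOrder β'] [OrderBot β']
    [DirComplete α] [DirComplete β] [DirComplete β'] :
    ScottContinuous fun p : StrictHom β β' × StrictHom α' α => StrictHom.conj p.1 p.2 := by
  refine scott_subtype (scott_pi fun m => scott_subtype (scott_pi fun x => ?_))
  refine ScottContinuous.comp (f := fun p : StrictHom β β' × StrictHom α' α => (p.1, m.1 (p.2.1 x)))
    (ScottContinuous.prodMk ScottContinuous.fst ?_) scott_apply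
  exact ((ScottContinuous.snd.comp StrictHom.dirClosed.scott_val).comp (scott_eval x)).comp m.2.1

/-- The action of the domain equation on a pair of functions in opposite directions. -/
noncomputable def Obj.map (f : StrictHom A B) (g : StrictHom B A) :
    StrictHom (Obj S L A) (Obj S L B) :=
  Obj.mapWith (fun _ _ => f) (fun _ _ => StrictHom.conj f (Seq.map fun _ => g))

theorem Obj.scott_map :
    ScottContinuous fun p : StrictHom A B × StrictHom B A => Obj.map (S := S) (L := L) p.1 p.2 := by
  have h : ScottContinuous fun p : StrictHom A B × StrictHom B A =>
      StrictHom.conj p.1 (Seq.map fun _ => p.2) := by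
    have h₁ : ScottContinuous fun p : StrictHom A B × StrictHom B A => fun _ : ℕ => p.2 :=
      scott_pi fun _ => ScottContinuous.snd
    have := scott_pair StrictHom.scott_conj ScottContinuous.fst (h₁.comp Seq.scott_map)
    exact this
  have h₁ : ScottContinuous fun p : StrictHom A B × StrictHom B A => fun (_ : S) (_ : L) => p.1 :=
    scott_pi fun _ => scott_pi fun _ => ScottContinuous.fst
  have h₂ : ScottContinuous fun p : StrictHom A B × StrictHom B A => fun (_ : S) (_ : L) =>
      StrictHom.conj p.1 (Seq.map fun _ => p.2) := scott_pi fun _ => scott_pi fun _ => h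
  have := scott_pair Obj.scott_mapWith h₁ h₂
  exact this

theorem Obj.map_id : Obj.map (S := S) (L := L) (StrictHom.id : StrictHom A A) StrictHom.id =
    StrictHom.id := by
  refine Subtype.ext (funext fun x => ?_)
  unfold Obj.map
  rw [Seq.map_id]
  induction x using WithBot.recBotCoe with
  | bot => rfl
  | coe c => rfl

theorem Obj.map_comp (f : StrictHom A B) (g : StrictHom B A) (f' : StrictHom B C)
    (g' : StrictHom C B) : (Obj.map (S := S) (L := L) f' g').comp (Obj.map f g) =
    Obj.map (f'.comp f) (g.comp g') := by
  refine Subtype.ext (funext fun x => ?_)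
  unfold Obj.map
  rw [Seq.map_comp]
  induction x using WithBot.recBotCoe with
  | bot => rfl
  | coe c => rfl

end Obj

/-! ### The canonical solution of the domain equation

The solution is the limit of the iterates of the right-hand side of the domain equation, starting
from the one-point domain. -/

instance : DirComplete Unit where
  exists_isLUB _ _ _ := ⟨(), fun _ _ => le_rfl, fun _ _ => le_rfl⟩

/-- A directed-complete partial order with a least element. -/
structure Dom where
  carrier : Type
  [po : PartialOrder carrier]
  [bot : OrderBot carrier]
  [complete : DirComplete carrier]

attribute [instance] Dom.po Dom.bot Dom.complete

/-- The iterates of the right-hand side of the domain equation. -/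
def iterDom (S L : Type) : ℕ → Dom
  | 0 => ⟨Unit⟩
  | n + 1 => ⟨Obj S L (iterDom S L n).carrier⟩

/-- The `n`-th iterate. -/
abbrev Iter (S L : Type) (n : ℕ) : Type := (iterDom S L n).carrier

section Limit

variable {S L : Type}

/-- The connecting maps between the `n`-th and the `m`-th iterate, in both directions: the one
from the smaller to the larger index is the embedding, the other one the projection. -/
noncomputable def connect : ∀ n m : ℕ,
    StrictHom (Iter S L n) (Iter S L m) × StrictHom (Iter S L m) (Iter S L n)
  | 0, _ => (⊥, ⊥)
  | _ + 1, 0 => (⊥, ⊥)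
  | n + 1, m + 1 =>
    (Obj.map (connect n m).1 (connect n m).2, Obj.map (connect n m).2 (connect n m).1)

/-- The connecting map from the `n`-th to the `m`-th iterate. -/
noncomputable def tr (n m : ℕ) : StrictHom (Iter S L n) (Iter S L m) := (connect n m).1

theorem connect_swap (n m : ℕ) : connect (S := S) (L := L) m n = (connect n m).swap := by
  induction n generalizing m with
  | zero => cases m <;> rfl
  | succ n ih =>
    cases m with
    | zero => rfl
    | succ m => simp only [connect, ih m, Prod.swap]

theorem tr_zero_left (m : ℕ) : tr (S := S) (L := L) 0 m = ⊥ := by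
  cases m <;> rfl

theorem tr_zero_right (n : ℕ) : tr (S := S) (L := L) n 0 = ⊥ := by
  cases n <;> rfl

theorem tr_succ (n m : ℕ) :
    tr (S := S) (L := L) (n + 1) (m + 1) = Obj.map (tr n m) (tr m n) := by
  have : (connect (S := S) (L := L) n m).2 = tr m n := by
    rw [tr, connect_swap n m]; rfl
  rw [← this]
  rfl

theorem Obj.map_mono {A B : Type} [PartialOrder A] [OrderBot A] [DirComplete A]
    [PartialOrder B] [OrderBot B] [DirComplete B] {f f' : StrictHom A B} {g g' : StrictHom B A}
    (hf : f ≤ f') (hg : g ≤ g') : Obj.map (S := S) (L := L) f g ≤ Obj.map f' g' :=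
  Obj.scott_map.monotone (show (f, g) ≤ (f', g') from ⟨hf, hg⟩)

theorem tr_self (n : ℕ) : tr (S := S) (L := L) n n = StrictHom.id := by
  induction n with
  | zero => rfl
  | succ n ih => rw [tr_succ, ih]; exact Obj.map_id

theorem tr_comp_le (n m k : ℕ) : (tr (S := S) (L := L) m k).comp (tr n m) ≤ tr n k := by
  induction m generalizing n k with
  | zero =>
    intro x
    rw [tr_zero_left]
    exact bot_le
  | succ m ih =>
    cases n with
    | zero =>
      intro x
      rw [tr_zero_left]
      exact ((tr (m + 1) k).2.2).le.trans bot_le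
    | succ n =>
      cases k with
      | zero => intro x; rw [tr_zero_right]; exact bot_le
      | succ k =>
        rw [tr_succ, tr_succ, tr_succ]
        refine (Obj.map_comp _ _ _ _).le.trans ?_
        exact Obj.map_mono (ih n k) (ih k n)

theorem tr_comp (n m k : ℕ) (h : n ≤ m ∨ k ≤ m) :
    (tr (S := S) (L := L) m k).comp (tr n m) = tr n k := by
  induction m generalizing n k with
  | zero =>
    rcases h with h | h
    · obtain rfl : n = 0 := by omega
      rw [tr_zero_left, tr_zero_left]
      rfl
    · obtain rfl : k = 0 := by omega
      rw [tr_zero_left, tr_zero_right n]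
      rfl
  | succ m ih =>
    cases n with
    | zero =>
      rw [tr_zero_left, tr_zero_left]
      exact Subtype.ext (funext fun _ => (tr (m + 1) k).2.2)
    | succ n =>
      cases k with
      | zero => rw [tr_zero_right, tr_zero_right]; rfl
      | succ k =>
        rw [tr_succ, tr_succ, tr_succ]
        refine (Obj.map_comp _ _ _ _).trans ?_
        rw [ih n k (by omega), ih k n (by omega)]

end Limit

/-- The limit of the iterates along the projections: the canonical solution of the domain equation
with signatures in `S` and labels in `L`. -/
abbrev Limit (S L : Type) : Type :=
  {x : ∀ n, Iter S L n // ∀ n m, m ≤ n → (tr n m).1 (x n) = x m}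

section Limit

variable {S L : Type}

theorem Limit.dirClosed : DirClosed fun x : ∀ n, Iter S L n =>
    ∀ n m, m ≤ n → (tr n m).1 (x n) = x m := by
  intro d hne hd hx a ha n m hmn
  have h₁ := (tr n m).2.1 (hne.image _) (hd.mono_comp fun _ _ h => h n) (isLUB_pi.1 ha n)
  rw [Set.image_image] at h₁
  have h₂ := isLUB_pi.1 ha m
  have : (fun x : ∀ n, Iter S L n => (tr n m).1 (Function.eval n x)) '' d = Function.eval m '' d :=
    Set.image_congr fun x h => hx x h n m hmn
  rw [this] at h₁
  exact h₁.unique h₂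

instance : DirComplete (Limit S L) := Limit.dirClosed.dirComplete

instance : OrderBot (Limit S L) where
  bot := ⟨fun _ => ⊥, fun n m _ => (tr n m).2.2⟩
  bot_le _ := fun _ => bot_le

/-- The projection of the limit to the `n`-th iterate. -/
def Limit.proj (n : ℕ) : StrictHom (Limit S L) (Iter S L n) :=
  ⟨fun x => x.1 n, scott_eval_comp Limit.dirClosed.scott_val n, rfl⟩

/-- The embedding of the `n`-th iterate into the limit. -/
noncomputable def Limit.emb (n : ℕ) : StrictHom (Iter S L n) (Limit S L) :=
  ⟨fun y => ⟨fun m => (tr n m).1 y, fun m k hkm =>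
    congrFun (congrArg Subtype.val (tr_comp n m k (Or.inr hkm))) y⟩,
    scott_subtype (scott_pi fun m => (tr n m).2.1),
    Subtype.ext (funext fun m => (tr n m).2.2)⟩

theorem Limit.tr_le (x : Limit S L) (n m : ℕ) : (tr n m).1 (x.1 n) ≤ x.1 m := by
  rcases le_total m n with h | h
  · exact (x.2 n m h).le
  · rw [← x.2 m n h]
    refine (tr_comp_le m n m (x.1 m)).trans ?_
    rw [tr_self]
    exact le_rfl

theorem Limit.emb_tr (n m : ℕ) (h : m ≤ n) :
    (Limit.emb (S := S) (L := L) n).comp (tr m n) = Limit.emb m :=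
  Subtype.ext (funext fun y => Subtype.ext (funext fun k =>
    congrFun (congrArg Subtype.val (tr_comp m n k (Or.inl h))) y))

theorem Limit.emb_tr_le (n m : ℕ) :
    (Limit.emb (S := S) (L := L) n).comp (tr m n) ≤ Limit.emb m :=
  fun y k => tr_comp_le m n k y

theorem Limit.tr_proj (n m : ℕ) (h : m ≤ n) :
    (tr n m).comp (Limit.proj (S := S) (L := L) n) = Limit.proj m :=
  Subtype.ext (funext fun x => x.2 n m h)

theorem Limit.tr_proj_le (n m : ℕ) :
    (tr n m).comp (Limit.proj (S := S) (L := L) n) ≤ Limit.proj m :=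
  fun x => Limit.tr_le x n m

theorem Limit.proj_emb (n m : ℕ) :
    (Limit.proj (S := S) (L := L) m).comp (Limit.emb n) = tr n m := rfl

/-- The `n`-th approximation of the identity of the limit. -/
noncomputable def Limit.approx (n : ℕ) : StrictHom (Limit S L) (Limit S L) :=
  (Limit.emb n).comp (Limit.proj n)

theorem Limit.approx_mono : Monotone (Limit.approx (S := S) (L := L)) := by
  refine monotone_nat_of_le_succ fun n x => ?_
  show (Limit.emb n).1 (x.1 n) ≤ (Limit.emb (n + 1)).1 (x.1 (n + 1))
  rw [← x.2 (n + 1) n (by omega)]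
  exact Limit.emb_tr_le n (n + 1) (x.1 (n + 1))

theorem Limit.isLUB_approx :
    IsLUB (Set.range (Limit.approx (S := S) (L := L))) StrictHom.id := by
  refine ⟨?_, fun u hu x m => ?_⟩
  · rintro _ ⟨n, rfl⟩ x m
    exact Limit.tr_le x n m
  · have := hu ⟨m, rfl⟩ x m
    refine le_trans (le_of_eq ?_) this
    exact (congrFun (congrArg Subtype.val (tr_self m)) (x.1 m)).symm

/-- The map from the right-hand side of the domain equation to its left-hand side. -/
noncomputable def Limit.fold (x : Obj S L (Limit S L)) : Limit S L :=
  ⟨fun n => match n with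
    | 0 => ⊥
    | n + 1 => (Obj.map (Limit.proj n) (Limit.emb n)).1 x, by
    intro n m hmn
    match n, m with
    | 0, m =>
      obtain rfl : m = 0 := by omega
      rfl
    | n + 1, 0 => exact Subsingleton.elim (α := Unit) _ _
    | n + 1, m + 1 =>
      have h := Obj.map_comp (S := S) (L := L) (Limit.proj (S := S) (L := L) n) (Limit.emb n)
        (tr n m) (tr m n)
      rw [Limit.tr_proj n m (by omega), Limit.emb_tr n m (by omega), ← tr_succ] at h
      exact congrFun (congrArg Subtype.val h) x⟩

theorem Limit.fold_mono : Monotone (Limit.fold (S := S) (L := L)) := by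
  intro x y h n
  cases n with
  | zero => exact le_rfl
  | succ n => exact (Obj.map (Limit.proj n) (Limit.emb n)).2.1.monotone h

theorem Limit.isLUB_fold (x : Obj S L (Limit S L)) : IsLUB (Set.range fun n =>
    (Obj.map (Limit.emb n) (Limit.proj n)).1 ((Limit.fold x).1 (n + 1))) x := by
  have hm : Monotone fun n => (Limit.approx (S := S) (L := L) n,
      Limit.approx (S := S) (L := L) n) :=
    fun _ _ h => ⟨Limit.approx_mono h, Limit.approx_mono h⟩
  have h₁ : IsLUB (Set.range fun n => (Limit.approx (S := S) (L := L) n,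
      Limit.approx (S := S) (L := L) n))
      (StrictHom.id, StrictHom.id) := by
    refine isLUB_prod.2 ⟨?_, ?_⟩
    all_goals
      rw [← Set.range_comp]
      exact Limit.isLUB_approx
  have h₂ := scott_isLUB_range (Obj.scott_map (S := S) (L := L)) hm h₁
  have h₃ : Monotone fun n => Obj.map (S := S) (L := L) (Limit.approx (S := S) (L := L) n)
      (Limit.approx (S := S) (L := L) n) := fun a b h => Obj.scott_map.monotone (hm h)
  have h₄ := scott_isLUB_range (scott_eval_comp (StrictHom.dirClosed.scott_val) x) h₃ h₂
  rw [Obj.map_id] at h₄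
  have h₅ : ∀ n, (Obj.map (S := S) (L := L) (Limit.approx (S := S) (L := L) n)
      (Limit.approx n)).1 x =
      (Obj.map (Limit.emb n) (Limit.proj n)).1 ((Limit.fold x).1 (n + 1)) := fun n =>
    (congrFun (congrArg Subtype.val (Obj.map_comp (S := S) (L := L) (Limit.proj n) (Limit.emb n)
      (Limit.emb n) (Limit.proj n))) x).symm
  simp only [h₅] at h₄
  exact h₄

theorem Limit.fold_le_iff (x y : Obj S L (Limit S L)) :
    Limit.fold x ≤ Limit.fold y ↔ x ≤ y := by
  refine ⟨fun h => (Limit.isLUB_fold x).2 ?_, fun h => Limit.fold_mono h⟩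
  rintro _ ⟨n, rfl⟩
  exact ((Obj.map (Limit.emb n) (Limit.proj n)).2.1.monotone (h (n + 1))).trans
    ((Limit.isLUB_fold y).1 ⟨n, rfl⟩)

theorem Limit.fold_surjective : Function.Surjective (Limit.fold (S := S) (L := L)) := by
  intro y
  have hm : Monotone fun n => (Obj.map (Limit.emb n) (Limit.proj n)).1 (y.1 (n + 1)) := by
    refine monotone_nat_of_le_succ fun n => ?_
    show (Obj.map (Limit.emb n) (Limit.proj n)).1 (y.1 (n + 1)) ≤ _
    rw [← y.2 (n + 2) (n + 1) (by omega), tr_succ]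
    refine (congrFun (congrArg Subtype.val (Obj.map_comp (S := S) (L := L) (tr (n + 1) n)
      (tr n (n + 1)) (Limit.emb n) (Limit.proj n))) (y.1 (n + 2))).le.trans ?_
    exact Obj.map_mono (Limit.emb_tr_le n (n + 1)) (Limit.tr_proj_le n (n + 1)) (y.1 (n + 2))
  obtain ⟨z, hz⟩ := DirComplete.exists_isLUB _ (Set.range_nonempty _)
    (directedOn_range.2 hm.directed_le)
  refine ⟨z, Subtype.ext (funext fun k => ?_)⟩
  cases k with
  | zero => exact Subsingleton.elim (α := Unit) _ _
  | succ m =>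
    have h := scott_isLUB_range (Obj.map (Limit.proj m) (Limit.emb m)).2.1 hm hz
    refine h.unique ?_
    have h₁ : ∀ n, (Obj.map (Limit.proj m) (Limit.emb m)).1
        ((Obj.map (Limit.emb n) (Limit.proj n)).1 (y.1 (n + 1))) =
        (tr (n + 1) (m + 1)).1 (y.1 (n + 1)) := fun n => by
      rw [tr_succ]
      exact congrFun (congrArg Subtype.val (Obj.map_comp (S := S) (L := L) (Limit.emb n)
        (Limit.proj n) (Limit.proj m) (Limit.emb m))) (y.1 (n + 1))
    simp only [h₁]
    refine ⟨?_, fun u hu => ?_⟩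
    · rintro _ ⟨n, rfl⟩
      exact Limit.tr_le y _ _
    · refine le_trans (le_of_eq ?_) (hu ⟨m, rfl⟩)
      exact (y.2 (m + 1) (m + 1) le_rfl).symm

/-- The limit solves the domain equation. -/
noncomputable def Limit.iso : Obj S L (Limit S L) ≃o Limit S L where
  toEquiv := Equiv.ofBijective Limit.fold ⟨fun x y h => le_antisymm
    ((Limit.fold_le_iff x y).1 h.le) ((Limit.fold_le_iff y x).1 h.ge), Limit.fold_surjective⟩
  map_rel_iff' := fun {x y} => Limit.fold_le_iff x y

end Limit

/-! ### Generic signatures -/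

/-- `GNX = GN + X` with `GN = N × GNX*`: type names, which are type variables or generic signature
names; a generic signature name is a signature constructor name with a list of type arguments. -/
inductive GNX (N X : Type) : Type
  | var (x : X) : GNX N X
  | app (nm : N) (args : List (GNX N X)) : GNX N X

/-- Generic signature names. -/
abbrev GN (N X : Type) : Type := N × List (GNX N X)

/-- Generic signature names are type names. -/
def GN.toGNX {N X : Type} (g : GN N X) : GNX N X := .app g.1 g.2

open Classical in
/-- Name substitution `{V ↦ TN}` on type names. -/
noncomputable def GNX.subst {N X : Type} (V : List X) (TN : List (GNX N X)) : GNX N X → GNX N X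
  | .var y => if y ∈ V then TN.getD (V.idxOf y) (.var y) else .var y
  | .app nm args => .app nm (args.map fun t => t.subst V TN)

/-- Name substitution on generic signature names. -/
noncomputable def GN.subst {N X : Type} (V : List X) (TN : List (GNX N X)) (g : GN N X) : GN N X :=
  (g.1, g.2.map fun t => t.subst V TN)

/-- Replacement of the type variables by elements of another set. -/
def GNX.rename {N X Y : Type} (f : X → Y) : GNX N X → GNX N Y
  | .var y => .var (f y)
  | .app nm args => .app nm (args.map fun t => t.rename f)

/-- Signature constructors: a name, the declared type variables, the supersignatures, the field
signatures, and the method signatures (a label, parameter types and a return type). -/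
structure SigCon (N X L : Type) : Type where
  name : N
  tvars : List X
  supers : List (GN N X)
  fields : List (L × GNX N X)
  methods : List (L × List (GNX N X) × GNX N X)

open Classical in
/-- The signature constructor with each declared type variable replaced by its position. -/
noncomputable def SigCon.canon {N X L : Type} (sc : SigCon N X L) : SigCon N ℕ L where
  name := sc.name
  tvars := List.range sc.tvars.length
  supers := sc.supers.map fun g => (g.1, g.2.map fun t => t.rename sc.tvars.idxOf)
  fields := sc.fields.map fun f => (f.1, f.2.rename sc.tvars.idxOf)
  methods := sc.methods.map fun m =>
    (m.1, m.2.1.map fun t => t.rename sc.tvars.idxOf, m.2.2.rename sc.tvars.idxOf)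

/-- Equality up to a consistent renaming of the declared type variables. -/
def SigCon.AlphaEq {N X L : Type} (sc sc' : SigCon N X L) : Prop := sc.canon = sc'.canon

/-- Signature constructor environments: finite partial functions from names to constructors. -/
structure SigConEnv (N X L : Type) : Type where
  lookup : N → Option (SigCon N X L)
  finite : {nm | lookup nm ≠ none}.Finite

/-- Well-formedness, in the environment `e`, of a type name with type variables in `V`: every
signature constructor name in it is bound by `e` and has the right number of arguments.  With
`V = []` there are no type variables, i.e. the name is ground. -/
inductive GNX.WF {N X L : Type} (e : SigConEnv N X L) (V : List X) : GNX N X → Prop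
  | var (x : X) (hx : x ∈ V) : GNX.WF e V (.var x)
  | app (nm : N) (args : List (GNX N X)) (sc : SigCon N X L) (hsc : e.lookup nm = some sc)
      (hlen : sc.tvars.length = args.length) (hargs : ∀ t ∈ args, GNX.WF e V t) :
      GNX.WF e V (.app nm args)

/-- Well-formed signature constructor environments. -/
structure SigConEnv.WF {N X L : Type} (e : SigConEnv N X L) : Prop where
  /-- a name is bound to a constructor with that name -/
  name_eq : ∀ nm sc, e.lookup nm = some sc → sc.name = nm
  tvars_nodup : ∀ nm sc, e.lookup nm = some sc → sc.tvars.Nodup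
  supers_nodup : ∀ nm sc, e.lookup nm = some sc → sc.supers.Nodup
  fields_nodup : ∀ nm sc, e.lookup nm = some sc → (sc.fields.map Prod.fst).Nodup
  methods_nodup : ∀ nm sc, e.lookup nm = some sc → (sc.methods.map Prod.fst).Nodup
  /-- all type names inside a constructor are well-formed, with declared type variables -/
  supers_wf : ∀ nm sc, e.lookup nm = some sc → ∀ g ∈ sc.supers, g.toGNX.WF e sc.tvars
  fields_wf : ∀ nm sc, e.lookup nm = some sc → ∀ f ∈ sc.fields, f.2.WF e sc.tvars
  methods_wf : ∀ nm sc, e.lookup nm = some sc → ∀ m ∈ sc.methods,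
    (∀ t ∈ m.2.1, t.WF e sc.tvars) ∧ m.2.2.WF e sc.tvars
  /-- no cycles among the supersignature constructors -/
  acyclic : ∀ nm, ¬ Relation.TransGen
    (fun a b => ∃ sc, e.lookup a = some sc ∧ ∃ g ∈ sc.supers, g.1 = b) nm nm
  /-- the members of the supersignature constructors, instantiated with the type arguments in the
  supersignatures component, are inherited with the same signatures -/
  inherits : ∀ nm sc, e.lookup nm = some sc → ∀ g ∈ sc.supers, ∀ sc', e.lookup g.1 = some sc' →
    (∀ f ∈ sc'.fields, (f.1, f.2.subst sc'.tvars g.2) ∈ sc.fields) ∧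
    (∀ m ∈ sc'.methods, (m.1, m.2.1.map (fun t => t.subst sc'.tvars g.2),
      m.2.2.subst sc'.tvars g.2) ∈ sc.methods)

/-- `e₂` extends `e₁`: up to renaming of type variables, `e₂` contains all bindings of `e₁`. -/
def SigConEnv.Extends {N X L : Type} (e₂ e₁ : SigConEnv N X L) : Prop :=
  ∀ nm sc₁, e₁.lookup nm = some sc₁ → ∃ sc₂, e₂.lookup nm = some sc₂ ∧ sc₂.AlphaEq sc₁

/-- Ground signatures: as signature constructors, but with a ground signature name as their name
and without type variables. -/
structure GroundSig (N X L : Type) : Type where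
  name : GN N X
  supers : List (GN N X)
  fields : List (L × GNX N X)
  methods : List (L × List (GNX N X) × GNX N X)

/-- The instance of a signature constructor with ground signature name `g`: the type arguments of
`g` are substituted for the type variables, and the type variables component is dropped. -/
noncomputable def SigCon.inst {N X L : Type} (sc : SigCon N X L) (g : GN N X) :
    GroundSig N X L where
  name := g
  supers := sc.supers.map fun s => s.subst sc.tvars g.2
  fields := sc.fields.map fun f => (f.1, f.2.subst sc.tvars g.2)
  methods := sc.methods.map fun m =>
    (m.1, m.2.1.map (fun t => t.subst sc.tvars g.2), m.2.2.subst sc.tvars g.2)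

/-- The ground signature named by `g` in the environment `e`. -/
noncomputable def SigConEnv.genToGnd {N X L : Type} (e : SigConEnv N X L) (g : GN N X) :
    Option (GroundSig N X L) :=
  (e.lookup g.1).bind fun sc => if sc.tvars.length = g.2.length then some (sc.inst g) else none

/-- The names of all ground supersignatures of `g`, obtained by following the supersignatures
hierarchy transitively. -/
def SigConEnv.gss {N X L : Type} (e : SigConEnv N X L) (g : GN N X) : Set (GN N X) :=
  {g' | Relation.TransGen (fun a b => ∃ gs, e.genToGnd a = some gs ∧ b ∈ gs.supers) g g'}

/-- Subsigning of pairs of a ground signature name and an environment. -/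
def RawSubsign {N X L : Type} (s₂ s₁ : GN N X × SigConEnv N X L) : Prop :=
  s₂.2.Extends s₁.2 ∧ (s₂.1 = s₁.1 ∨ s₁.1 ∈ s₂.2.gss s₂.1)

/-- Representatives of generic object signatures: a well-formed environment and a ground signature
name that is well-formed in it. -/
abbrev PreGenObjSig (N X L : Type) : Type :=
  {s : GN N X × SigConEnv N X L // s.2.WF ∧ s.1.toGNX.WF s.2 []}

/-- Equality of generic object signatures up to renaming of the type variables. -/
instance genObjSigSetoid (N X L : Type) : Setoid (PreGenObjSig N X L) where
  r s s' := s.1.1 = s'.1.1 ∧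
    ∀ nm, (s.1.2.lookup nm).map SigCon.canon = (s'.1.2.lookup nm).map SigCon.canon
  iseqv := ⟨fun _ => ⟨rfl, fun _ => rfl⟩, fun h => ⟨h.1.symm, fun nm => (h.2 nm).symm⟩,
    fun h h' => ⟨h.1.trans h'.1, fun nm => (h.2 nm).trans (h'.2 nm)⟩⟩

/-- Generic object signatures, equal if they are equal up to renaming of type variables. -/
abbrev GenObjSig (N X L : Type) : Type := Quotient (genObjSigSetoid N X L)

section Alpha

variable {N X L : Type}

/-- Replace the variable `i` by the entry of `TN` at `i`, and by `d` beyond the length of `TN`. -/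
noncomputable def GNX.instNat (TN : List (GNX N X)) (d : GNX N X) : GNX N ℕ → GNX N X
  | .var i => TN.getD i d
  | .app nm args => .app nm (args.map fun t => GNX.instNat TN d t)

theorem GNX.subst_eq_instNat {e : SigConEnv N X L} {V : List X} {TN : List (GNX N X)}
    (hlen : V.length = TN.length) (d : GNX N X) {t : GNX N X} (ht : t.WF e V) :
    t.subst V TN = GNX.instNat TN d (t.rename (open Classical in V.idxOf)) := by
  classical
  induction ht with
  | var x hx =>
    have h : V.idxOf x < TN.length := hlen ▸ List.idxOf_lt_length_iff.2 hx
    rw [GNX.subst, if_pos hx, GNX.rename, GNX.instNat]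
    rw [List.getD_eq_getElem _ _ (by convert h), List.getD_eq_getElem _ _ (by convert h)]
  | app nm args sc hsc hl hargs ih =>
    rw [GNX.subst, GNX.rename, GNX.instNat, List.map_map]
    exact congrArg _ (List.map_congr_left ih)

/-- The instance of a signature constructor in which type variables are replaced by positions. -/
noncomputable def SigCon.instNat (c : SigCon N ℕ L) (g : GN N X) : GroundSig N X L where
  name := g
  supers := c.supers.map fun s => (s.1, s.2.map fun t => GNX.instNat g.2 g.toGNX t)
  fields := c.fields.map fun f => (f.1, GNX.instNat g.2 g.toGNX f.2)
  methods := c.methods.map fun m =>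
    (m.1, m.2.1.map (fun t => GNX.instNat g.2 g.toGNX t), GNX.instNat g.2 g.toGNX m.2.2)

theorem SigConEnv.WF.inst_eq {e : SigConEnv N X L} (he : e.WF) {nm : N} {sc : SigCon N X L}
    (hsc : e.lookup nm = some sc) {g : GN N X} (hlen : sc.tvars.length = g.2.length) :
    sc.inst g = sc.canon.instNat g := by
  have hs : sc.supers.map (fun s => s.subst sc.tvars g.2) = (sc.canon.instNat g).supers := by
    simp only [SigCon.canon, SigCon.instNat, List.map_map]
    refine List.map_congr_left fun s h => ?_
    have hw := he.supers_wf nm sc hsc s h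
    cases hw with
    | app _ _ _ _ _ ha =>
      simp only [GN.subst, Function.comp, List.map_map]
      exact congrArg _ (List.map_congr_left fun t ht => GNX.subst_eq_instNat hlen g.toGNX (ha t ht))
  have hf : sc.fields.map (fun f => (f.1, f.2.subst sc.tvars g.2)) =
      (sc.canon.instNat g).fields := by
    simp only [SigCon.canon, SigCon.instNat, List.map_map]
    refine List.map_congr_left fun f h => ?_
    exact congrArg _ (GNX.subst_eq_instNat hlen g.toGNX (he.fields_wf nm sc hsc f h))
  have hm : sc.methods.map (fun m => (m.1, m.2.1.map (fun t => t.subst sc.tvars g.2),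
      m.2.2.subst sc.tvars g.2)) = (sc.canon.instNat g).methods := by
    simp only [SigCon.canon, SigCon.instNat, List.map_map]
    refine List.map_congr_left fun m h => ?_
    obtain ⟨h₁, h₂⟩ := he.methods_wf nm sc hsc m h
    simp only [Function.comp, List.map_map]
    rw [GNX.subst_eq_instNat hlen g.toGNX h₂]
    exact congrArg (fun x => (m.1, x, _))
      (List.map_congr_left fun t ht => GNX.subst_eq_instNat hlen g.toGNX (h₁ t ht))
  unfold SigCon.inst
  rw [hs, hf, hm]
  rfl

theorem genToGnd_congr {s s' : PreGenObjSig N X L} (h : s ≈ s') (g : GN N X) :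
    s.1.2.genToGnd g = s'.1.2.genToGnd g := by
  have h₁ := h.2 g.1
  unfold SigConEnv.genToGnd
  cases h₂ : s.1.2.lookup g.1 with
  | none =>
    cases h₃ : s'.1.2.lookup g.1 with
    | none => rfl
    | some sc' => simp [h₂, h₃] at h₁
  | some sc =>
    cases h₃ : s'.1.2.lookup g.1 with
    | none => simp [h₂, h₃] at h₁
    | some sc' =>
      have h₄ : sc.canon = sc'.canon := by simpa [h₂, h₃] using h₁
      have h₅ : sc.tvars.length = sc'.tvars.length := by
        simpa [SigCon.canon] using congrArg (fun c => c.tvars.length) h₄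
      simp only [Option.bind_some, ← h₅]
      split_ifs with h₆
      · rw [s.2.1.inst_eq h₂ h₆, s'.2.1.inst_eq h₃ (h₅ ▸ h₆), h₄]
      · rfl

theorem rawSubsign_congr {s s' t t' : PreGenObjSig N X L} (hs : s ≈ s') (ht : t ≈ t')
    (g : GN N X) : RawSubsign s.1 (g, t.1.2) = RawSubsign s'.1 (g, t'.1.2) := by
  have hgss : s.1.2.gss s.1.1 = s'.1.2.gss s'.1.1 := by
    unfold SigConEnv.gss
    simp only [genToGnd_congr hs, hs.1]
  have key : ∀ {s s' t t' : PreGenObjSig N X L}, s ≈ s' → t ≈ t' →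
      s.1.2.Extends t.1.2 → s'.1.2.Extends t'.1.2 := by
    intro s s' t t' hs ht h nm sc₁ hsc₁
    have h₁ := ht.2 nm
    rw [hsc₁, Option.map_some, Option.map_eq_some_iff] at h₁
    obtain ⟨sc, hsc, hc⟩ := h₁
    obtain ⟨sc₂, hsc₂, hc₂⟩ := h nm sc hsc
    have h₂ := hs.2 nm
    rw [hsc₂, Option.map_some, eq_comm, Option.map_eq_some_iff] at h₂
    obtain ⟨sc₃, hsc₃, hc₃⟩ := h₂
    exact ⟨sc₃, hsc₃, hc₃.trans (Eq.trans hc₂ hc)⟩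
  unfold RawSubsign
  rw [hgss, hs.1]
  exact propext ⟨fun h => ⟨key hs ht h.1, h.2⟩,
    fun h => ⟨key (Setoid.symm hs) (Setoid.symm ht) h.1, h.2⟩⟩

end Alpha

namespace GenObjSig

variable {N X L : Type}

/-- The ground signature that a generic object signature defines. -/
noncomputable def gnd (s : GenObjSig N X L) : Option (GroundSig N X L) :=
  Quotient.liftOn s (fun s => s.1.2.genToGnd s.1.1) fun s s' h => by
    show s.1.2.genToGnd s.1.1 = s'.1.2.genToGnd s'.1.1
    rw [genToGnd_congr h, h.1]

/-- Subsigning of generic object signatures. -/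
def Subsign (s₂ s₁ : GenObjSig N X L) : Prop :=
  Quotient.liftOn₂ s₂ s₁ (fun s₂ s₁ => RawSubsign s₂.1 s₁.1) fun s₂ s₁ s₂' s₁' h₂ h₁ => by
    have := rawSubsign_congr h₂ h₁ s₁.1.1
    rwa [show (s₁.1.1, s₁'.1.2) = s₁'.1 by rw [h₁.1]] at this

/-- `s'` subsigns the pair of the ground signature name `g` and the environment of `s`. -/
def Accepts (s : GenObjSig N X L) (g : GN N X) (s' : GenObjSig N X L) : Prop :=
  Quotient.liftOn₂ s' s (fun s' s => RawSubsign s'.1 (g, s.1.2)) fun _ _ _ _ h' h =>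
    rawSubsign_congr h' h g

end GenObjSig

/-! ### Generic objects -/

section Gate

variable {Y : Type} [PartialOrder Y]

open Classical in
/-- Replace the elements that do not satisfy `P` by `⊥`, for a property `P` that does not
distinguish comparable elements. -/
noncomputable def gateFun (P : Y → Prop) (y : Y) : WithBot Y := if P y then (y : WithBot Y) else ⊥

theorem scott_gateFun {P : Y → Prop} (hP : ∀ y y', y ≤ y' → (P y ↔ P y')) :
    ScottContinuous (gateFun P) := by
  intro d hne hd a ha
  by_cases h : P a
  · have h₁ : gateFun P '' d = (fun y : Y => (y : WithBot Y)) '' d :=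
      Set.image_congr fun x hx => if_pos ((hP x a (ha.1 hx)).2 h)
    rw [h₁, gateFun, if_pos h]
    exact scott_coe hne hd ha
  · have h₁ : gateFun P '' d = (fun _ : Y => (⊥ : WithBot Y)) '' d :=
      Set.image_congr fun x hx => if_neg fun hx' => h ((hP x a (ha.1 hx)).1 hx')
    rw [h₁, gateFun, if_neg h]
    exact ScottContinuous.const _ hne hd ha

/-- `gateFun` as a strict continuous function. -/
noncomputable def gate (P : Y → Prop) (hP : ∀ y y', y ≤ y' → (P y ↔ P y')) :
    StrictHom (WithBot Y) (WithBot Y) :=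
  StrictHom.ext (gateFun P) (scott_gateFun hP)

end Gate

/-- The canonical solution `O` of the domain equation `O = S × (L ⊸ O) × (L ⊸ (O* → O))`, where
`S` is the flat domain of generic object signatures. -/
abbrev PreObj (N X L : Type) : Type := Limit (GenObjSig N X L) L

/-- The nonbottom right-hand sides of the domain equation. -/
abbrev ObjCell (N X L : Type) : Type := Cell (GenObjSig N X L) L (PreObj N X L)

/-- Methods: strict continuous functions from sequences of objects to objects. -/
abbrev Method (N X L : Type) : Type := StrictHom (Seq (PreObj N X L)) (PreObj N X L)

/-- Generic object records: pairs of a record of fields and a record of methods. -/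
abbrev ObjRecord (N X L : Type) : Type :=
  Record L (PreObj N X L) × Record L (Method N X L)

section Filter

variable {N X L : Type}

/-- The isomorphism from the right-hand side of the domain equation to its left-hand side. -/
noncomputable def roll : StrictHom (WithBot (ObjCell N X L)) (PreObj N X L) :=
  ⟨Limit.iso, fun _ _ _ _ h => Limit.iso.isLUB_image'.2 h, map_bot Limit.iso⟩

/-- The isomorphism from the left-hand side of the domain equation to its right-hand side. -/
noncomputable def unroll : StrictHom (PreObj N X L) (WithBot (ObjCell N X L)) :=
  ⟨Limit.iso.symm, fun _ _ _ _ h => Limit.iso.symm.isLUB_image'.2 h, map_bot Limit.iso.symm⟩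

/-- The pair of a generic object signature and a generic object record. -/
noncomputable def mkObj (s : GenObjSig N X L) (r : ObjRecord N X L) : PreObj N X L :=
  roll.1 (((⟨s⟩, r) : ObjCell N X L) : WithBot (ObjCell N X L))

/-- Keep the objects whose signature satisfies `P`, and replace the other ones by `⊥`. -/
noncomputable def sigGate (P : GenObjSig N X L → Prop) : StrictHom (PreObj N X L) (PreObj N X L) :=
  roll.comp ((gate (fun c : ObjCell N X L => P c.1.val) fun c c' h => by
    rw [Discrete.eq_of_le (h.1 : c.1 ≤ c'.1)]).comp unroll)

/-- Keep the sequences whose length satisfies `P`, and replace the other ones by `⊥`. -/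
noncomputable def lengthGate (P : ℕ → Prop) :
    StrictHom (Seq (PreObj N X L)) (Seq (PreObj N X L)) :=
  gate (fun t : ProperSeq (PreObj N X L) => P t.1.1.val) fun t t' h => by
    rw [Discrete.eq_of_le (h.1 : t.1.1 ≤ t'.1.1)]

/-- Member labels match: the labels of the field record and of the method record are the labels
of the field signatures and of the method signatures of the ground signature defined by `s`. -/
def ShapeMatch (s : GenObjSig N X L) (fields methods : Finset L) : Prop :=
  ∃ gs, s.gnd = some gs ∧ (∀ l, l ∈ fields ↔ l ∈ gs.fields.map Prod.fst) ∧
    ∀ l, l ∈ methods ↔ l ∈ gs.methods.map Prod.fst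

/-- Keep the triples of a signature and two records whose member labels match, and replace the
other ones by `⊥`. -/
noncomputable def shapeGate : StrictHom (WithBot (ObjCell N X L)) (WithBot (ObjCell N X L)) :=
  gate (fun c : ObjCell N X L => ShapeMatch c.1.val c.2.1.shape c.2.2.shape) fun c c' h => by
    unfold Record.shape
    rw [Discrete.eq_of_le (h.1 : c.1 ≤ c'.1), Discrete.eq_of_le (h.2.1.1 : c.2.1.1.1 ≤ c'.2.1.1.1),
      Discrete.eq_of_le (h.2.2.1 : c.2.2.1.1 ≤ c'.2.2.1.1)]

/-- `s'` subsigns the declared type of the field `l` of `s`. -/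
def FieldMatch (s : GenObjSig N X L) (l : L) (s' : GenObjSig N X L) : Prop :=
  ∃ gs, s.gnd = some gs ∧ ∃ g : GN N X, (l, g.toGNX) ∈ gs.fields ∧ s.Accepts g s'

/-- `n` is the number of parameters of the method `l` of `s`. -/
def ArityMatch (s : GenObjSig N X L) (l : L) (n : ℕ) : Prop :=
  ∃ gs, s.gnd = some gs ∧ ∃ ps r, (l, ps, r) ∈ gs.methods ∧ ps.length = n

/-- `s'` subsigns the declared type of the `i`-th parameter of the method `l` of `s`. -/
def ParamMatch (s : GenObjSig N X L) (l : L) (i : ℕ) (s' : GenObjSig N X L) : Prop :=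
  ∃ gs, s.gnd = some gs ∧ ∃ ps r, (l, ps, r) ∈ gs.methods ∧
    ∃ g : GN N X, ps[i]? = some g.toGNX ∧ s.Accepts g s'

/-- `s'` subsigns the declared return type of the method `l` of `s`. -/
def ReturnMatch (s : GenObjSig N X L) (l : L) (s' : GenObjSig N X L) : Prop :=
  ∃ gs, s.gnd = some gs ∧ ∃ ps, ∃ g : GN N X, (l, ps, g.toGNX) ∈ gs.methods ∧ s.Accepts g s'

/-- One unfolding of filtering, where `F` filters the objects inside an object. An object whose
member labels do not match its signature becomes `⊥`.  In any other object the signature is kept,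
a field value is filtered and becomes `⊥` if its signature does not match, and a method filters
its arguments and its result, and yields `⊥` if the signature of an argument or of the result
does not match. -/
noncomputable def filterStep (F : StrictHom (PreObj N X L) (PreObj N X L)) :
    StrictHom (PreObj N X L) (PreObj N X L) :=
  roll.comp ((Obj.mapWith
    (fun s l => F.comp (sigGate (FieldMatch s l)))
    (fun s l => StrictHom.conj (F.comp (sigGate (ReturnMatch s l)))
      ((Seq.map fun i => F.comp (sigGate (ParamMatch s l i))).comp
        (lengthGate (ArityMatch s l))))).comp
    (shapeGate.comp unroll))

theorem filterStep_mono : Monotone (filterStep (N := N) (X := X) (L := L)) := by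
  intro F G h x
  have h₁ : (fun (s : GenObjSig N X L) (l : L) => F.comp (sigGate (FieldMatch s l))) ≤
      fun s l => G.comp (sigGate (FieldMatch s l)) := fun s l x => h _
  have h₂ : (fun (s : GenObjSig N X L) (l : L) =>
      StrictHom.conj (F.comp (sigGate (ReturnMatch s l)))
        ((Seq.map fun i => F.comp (sigGate (ParamMatch s l i))).comp
          (lengthGate (ArityMatch s l)))) ≤
      fun s l => StrictHom.conj (G.comp (sigGate (ReturnMatch s l)))
        ((Seq.map fun i => G.comp (sigGate (ParamMatch s l i))).comp
          (lengthGate (ArityMatch s l))) := by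
    intro s l
    have h₄ : F.comp (sigGate (ReturnMatch s l)) ≤ G.comp (sigGate (ReturnMatch s l)) :=
      fun x => h _
    refine StrictHom.scott_conj.monotone (Prod.mk_le_mk.2 ⟨h₄, fun x => ?_⟩)
    have h₃ : (fun i => F.comp (sigGate (ParamMatch s l i))) ≤
        fun i => G.comp (sigGate (ParamMatch s l i)) := fun i x => h _
    exact Seq.scott_map.monotone h₃ _
  exact roll.2.1.monotone (Obj.scott_mapWith.monotone (Prod.mk_le_mk.2 ⟨h₁, h₂⟩) _)

/-- The iterates of `filterStep`, starting from the constant function `⊥`. -/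
noncomputable def filterIter (n : ℕ) : StrictHom (PreObj N X L) (PreObj N X L) :=
  filterStep^[n] ⊥

theorem filterIter_mono : Monotone (filterIter (N := N) (X := X) (L := L)) := by
  refine monotone_nat_of_le_succ fun n => ?_
  induction n with
  | zero => exact bot_le
  | succ n ih =>
    unfold filterIter at ih ⊢
    rw [Function.iterate_succ_apply', Function.iterate_succ_apply' _ (n + 1)]
    exact filterStep_mono ih

theorem exists_filter : ∃ F, IsLUB (Set.range (filterIter (N := N) (X := X) (L := L))) F :=
  DirComplete.exists_isLUB _ (Set.range_nonempty _) (directedOn_range.2 filterIter_mono.directed_le)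

/-- Filtering: the least fixed point of `filterStep`, i.e. the supremum of its iterates. -/
noncomputable def filter : StrictHom (PreObj N X L) (PreObj N X L) := exists_filter.choose

end Filter

/-- The domain of generic objects: the objects, in the solution of the domain equation, that are
not changed by filtering, with the order of that solution. -/
abbrev GenObj (N X L : Type) : Type := {o : PreObj N X L // filter.1 o = o}

section GenObj

variable {N X L : Type}

theorem GenObj.dirClosed : DirClosed fun o : PreObj N X L => filter.1 o = o := by
  intro d hne hd h a ha
  have h₁ := filter.2.1 hne hd ha
  rw [Set.image_congr h, Set.image_id'] at h₁
  exact h₁.unique ha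

instance : DirComplete (GenObj N X L) := GenObj.dirClosed.dirComplete

instance : OrderBot (GenObj N X L) where
  bot := ⟨⊥, filter.2.2⟩
  bot_le _ := bot_le (α := PreObj N X L)

/-- The generic nominal type denoted by a generic object signature: the generic objects that
approximate a generic object whose signature subsigns the given one. -/
def nominalType (gos : GenObjSig N X L) : Set (GenObj N X L) :=
  {go | ∃ (goss : GenObjSig N X L) (gr : ObjRecord N X L) (h : filter.1 (mkObj goss gr) =
    mkObj goss gr), goss.Subsign gos ∧ go ≤ ⟨mkObj goss gr, h⟩}

end GenObj

/-- Weak ideals: nonempty downward closed subsets that are closed under least upper bounds of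
directed subsets. -/
structure IsWeakIdeal {α : Type} [PartialOrder α] (A : Set α) : Prop where
  nonempty : A.Nonempty
  lower : IsLowerSet A
  lub_mem : ∀ d ⊆ A, d.Nonempty → DirectedOn (· ≤ ·) d → ∃ a ∈ A, IsLUB d a

end GNOOP

namespace GNOOP

section NominalType

variable {N X L : Type}

/-! The order on signatures is flat, so two comparable nonbottom objects carry the same signature
(`mkObj_le_mkObj`). Hence a nonbottom generic object that approximates an object with a signature
subsigning `gos` has that very signature, and it can serve as its own witness. In effect the nominal
type consists of `⊥` and of all generic objects whose signature subsigns `gos`. Such a set passes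
upward from any of its nonbottom elements (`mem_nominalType_of_le`).

Closure under directed suprema follows from this. The supremum exists among generic objects because
filtering is Scott continuous, so that its fixed points are closed under directed suprema. If every
element of the directed set is `⊥`, so is the supremum; otherwise the supremum lies above a
nonbottom element of the type and has the same signature. Downward closure is transitivity of the
order.

The one point that needs a construction is that `⊥` belongs to the type: there must be at least one
generic object whose signature subsigns `gos`. The signature `gos` itself will do, together with the
object that has exactly the declared member labels and the value `⊥` at each of them. Its labels
match, so filtering does not discard it, and all operations on members are strict, so they leave `⊥`
in place. It is therefore fixed by one unfolding of filtering, whatever map is used for the inner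
objects (`filterStep_mkObj_const`), and consequently by filtering itself
(`filter_eq_self_of_filterStep`). -/

theorem GenObjSig.exists_gnd (s : GenObjSig N X L) : ∃ gs, s.gnd = some gs := by
  induction s using Quotient.inductionOn with
  | h s =>
    obtain ⟨⟨⟨nm, args⟩, e⟩, _, hg⟩ := s
    -- Only the `app` rule can derive well-formedness here. It provides both facts that `genToGnd`
    -- tests: the name is bound, and the number of arguments is right.
    cases hg with
    | app _ _ sc hsc hlen _ =>
      refine ⟨sc.inst (nm, args), ?_⟩
      show e.genToGnd (nm, args) = _
      unfold SigConEnv.genToGnd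
      rw [show e.lookup nm = some sc from hsc]
      exact if_pos hlen

/-- Allows an object with signature `gos` to witness membership in the nominal type of `gos`. -/
theorem GenObjSig.subsign_refl (s : GenObjSig N X L) : s.Subsign s := by
  induction s using Quotient.inductionOn with
  | h s => exact ⟨fun _ sc h => ⟨sc, h, rfl⟩, Or.inl rfl⟩

/-! ### Nonbottom objects as pairs of a signature and a record -/

theorem unroll_roll (c : WithBot (ObjCell N X L)) : unroll.1 (roll.1 c) = c :=
  Limit.iso.symm_apply_apply c

/-- The solution of the domain equation is order-isomorphic to its right-hand side, where nonbottom
elements are compared componentwise and the signature component is discrete. The equality of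
signatures obtained here is what makes nominal types closed under suprema. -/
theorem mkObj_le_mkObj {s s' : GenObjSig N X L} {r r' : ObjRecord N X L} :
    mkObj s r ≤ mkObj s' r' ↔ s = s' ∧ r ≤ r' := by
  refine (Limit.iso.map_rel_iff).trans (WithBot.coe_le_coe.trans ?_)
  refine ⟨fun h => ⟨congrArg Discrete.val (Discrete.eq_of_le h.1), h.2⟩, ?_⟩
  rintro ⟨rfl, h⟩
  exact ⟨le_rfl, h⟩

theorem mkObj_ne_bot (s : GenObjSig N X L) (r : ObjRecord N X L) : mkObj s r ≠ ⊥ := by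
  intro h
  have h₁ := congrArg unroll.1 h
  rw [unroll.2.2, mkObj, unroll_roll] at h₁
  exact WithBot.coe_ne_bot h₁

/-- Every object is the image under the isomorphism of an element of the lifted right-hand side, and
the isomorphism preserves `⊥`; only the lifted triples remain. -/
theorem exists_mkObj_of_ne_bot {o : PreObj N X L} (ho : o ≠ ⊥) : ∃ s r, o = mkObj s r := by
  obtain ⟨c, rfl⟩ := (Limit.iso (S := GenObjSig N X L) (L := L)).surjective o
  induction c using WithBot.recBotCoe with
  | bot => exact absurd (map_bot Limit.iso) ho
  | coe c => exact ⟨c.1.val, c.2, rfl⟩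

/-! ### An object with bottom members that filtering keeps -/

/-- The record with value `⊥` at every label of its shape. -/
def Record.const {L : Type} (D : Type) [PartialOrder D] [OrderBot D] (A : Finset L) :
    Record L D :=
  ⟨(⟨A⟩, fun _ => ⊥), fun _ _ => rfl⟩

/-- Holds by strictness of each `φ l`. It serves for fields and for methods alike: in the method
record `⊥` is the constantly `⊥` function, and the map that sandwiches a method between filters is
again strict. -/
theorem Record.map_const {L D E : Type} [PartialOrder D] [OrderBot D] [PartialOrder E] [OrderBot E]
    (φ : L → StrictHom D E) (A : Finset L) :
    Record.map φ (Record.const D A) = Record.const E A :=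
  Subtype.ext (Prod.ext rfl (funext fun l => (φ l).2.2))

theorem filterStep_mkObj_const (F : StrictHom (PreObj N X L) (PreObj N X L))
    {s : GenObjSig N X L} {A B : Finset L} (h : ShapeMatch s A B) :
    (filterStep F).1 (mkObj s (Record.const _ A, Record.const _ B)) =
      mkObj s (Record.const _ A, Record.const _ B) := by
  have hgate : shapeGate.1 (((⟨s⟩, Record.const _ A, Record.const _ B) : ObjCell N X L) :
      WithBot (ObjCell N X L)) =
      (((⟨s⟩, Record.const _ A, Record.const _ B) : ObjCell N X L) : WithBot (ObjCell N X L)) :=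
    -- The shapes of the two constant records are `A` and `B` by definition, so `h` is literally the
    -- condition tested by the gate.
    if_pos h
  unfold filterStep mkObj
  show roll.1 ((Obj.mapWith _ _).1 (shapeGate.1 (unroll.1 (roll.1 _)))) = _
  rw [unroll_roll, hgate]
  refine congrArg (fun c : ObjCell N X L => roll.1 (c : WithBot (ObjCell N X L))) ?_
  exact Prod.ext rfl (Prod.ext (Record.map_const _ A) (Record.map_const _ B))

/-- Filtering is the supremum of the iterates of `filterStep`, and suprema of strict continuous
functions are pointwise. Under the hypothesis every iterate after the initial one fixes `o`, so the
supremum does too. Quantifying over all `F` avoids any appeal to the fixed point equation of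
`filter`. -/
theorem filter_eq_self_of_filterStep {o : PreObj N X L}
    (h : ∀ F : StrictHom (PreObj N X L) (PreObj N X L), (filterStep F).1 o = o) :
    filter.1 o = o := by
  have h₁ : IsLUB (Set.range fun n => (filterIter (N := N) (X := X) (L := L) n).1 o)
      (filter.1 o) :=
    scott_isLUB_range (scott_eval_comp StrictHom.dirClosed.scott_val o) filterIter_mono
      exists_filter.choose_spec
  have h₂ : ∀ n, (filterIter (N := N) (X := X) (L := L) (n + 1)).1 o = o := fun n => by
    unfold filterIter
    rw [Function.iterate_succ_apply']
    exact h _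
  refine le_antisymm (h₁.2 ?_) ?_
  · rintro _ ⟨n, rfl⟩
    -- The bound is taken through the next iterate, since for `n = 0` the iterate is the constant
    -- `⊥` and need not fix `o`.
    exact (filterIter_mono (Nat.le_succ n) o).trans (h₂ n).le
  · exact (h₂ 0).ge.trans (h₁.1 ⟨1, rfl⟩)

theorem exists_filter_mkObj_eq (s : GenObjSig N X L) :
    ∃ r : ObjRecord N X L, filter.1 (mkObj s r) = mkObj s r := by
  classical
  obtain ⟨gs, hgs⟩ := s.exists_gnd
  -- The label sets are read off the ground signature, which makes `ShapeMatch` hold by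
  -- construction.
  exact ⟨_, filter_eq_self_of_filterStep fun F => filterStep_mkObj_const F
    (A := (gs.fields.map Prod.fst).toFinset) (B := (gs.methods.map Prod.fst).toFinset)
    ⟨gs, hgs, fun _ => List.mem_toFinset, fun _ => List.mem_toFinset⟩⟩

/-! ### Membership in nominal types -/

theorem bot_mem_nominalType (gos : GenObjSig N X L) : ⊥ ∈ nominalType gos := by
  obtain ⟨r, hr⟩ := exists_filter_mkObj_eq gos
  exact ⟨gos, r, hr, gos.subsign_refl, bot_le⟩

/-- A generic object above a nonbottom element of a nominal type belongs to that type, as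
comparable nonbottom objects have the same signature. -/
theorem mem_nominalType_of_le {gos : GenObjSig N X L} {x a : GenObj N X L}
    (hx : x ∈ nominalType gos) (hxa : x ≤ a) (hne : x ≠ ⊥) : a ∈ nominalType gos := by
  obtain ⟨x, hxf⟩ := x
  obtain ⟨a, haf⟩ := a
  obtain ⟨goss, gr, _, hsub, hle⟩ := hx
  obtain ⟨s, r, rfl⟩ := exists_mkObj_of_ne_bot fun h => hne (Subtype.ext h)
  -- The upper element is nonbottom because it lies above the nonbottom object `mkObj s r`, so it
  -- has a signature `t` to compare.
  obtain ⟨t, u, rfl⟩ := exists_mkObj_of_ne_bot fun h : a = ⊥ =>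
    mkObj_ne_bot s r (le_bot_iff.1 (h ▸ hxa))
  have h₁ := (mkObj_le_mkObj.1 hle).1
  have h₂ := (mkObj_le_mkObj.1 hxa).1
  -- The three signatures `goss`, `s` and `t` coincide. The upper element is its own witness, as it
  -- is fixed by filtering; the object above `x` given by the hypothesis may be unrelated to it.
  exact ⟨t, u, haf, h₂ ▸ h₁ ▸ hsub, le_rfl⟩

end NominalType

end GNOOP

theorem mainTheorem2 (N X L : Type) (gos : GNOOP.GenObjSig N X L) :
    GNOOP.IsWeakIdeal (GNOOP.nominalType gos) := by
  refine ⟨⟨⊥, GNOOP.bot_mem_nominalType gos⟩, ?_, fun d hd hne hdir => ?_⟩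
  · rintro x y hyx ⟨goss, gr, h, hsub, hle⟩
    exact ⟨goss, gr, h, hsub, hyx.trans hle⟩
  -- The supremum is taken in the domain of generic objects, so `a` is already fixed by filtering.
  · obtain ⟨a, ha⟩ := GNOOP.DirComplete.exists_isLUB d hne hdir
    refine ⟨a, ?_, ha⟩
    -- An element `⊥` carries no signature, and the objects witnessing its membership say nothing
    -- about `a`; a nonbottom element of `d` is needed to determine the signature of `a`.
    by_cases hbot : ∀ x ∈ d, x = ⊥
    · rw [GNOOP.isLUB_bot_of_forall ha hbot]
      exact GNOOP.bot_mem_nominalType gos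
    · push Not at hbot
      obtain ⟨x, hx, hxne⟩ := hbot
      exact GNOOP.mem_nominalType_of_le (hd hx) (ha.1 hx) hxne
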